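/- Let $F$ be a field of characteristic $2$. For a power series $f$ in $s$ variables $x_1,\dots,x_s$ over $F$ and $n\ge 0$ put $$e_n(f)=\dim_F F[[x_1,\dots,x_s]]/(x_1^{q},\dots,x_s^{q},f),\qquad q=2^n$$ (the Hilbert–Kunz function of $f$). For a power series $g$ in $r\ge 0$ variables over $F$, let $G=uv+g$, a power series in $r+2$ variables, where $u,v$ are two new variables, and define $$\theta_g=(1-2^{r+1}w)\sum_{n\ge 0}e_n(G)\,w^n\in\mathbb{Z}[[w]].$$ Theorem. Let $g$ be a power series in $r$ variables over $F$ with zero constant term, and let $h=g^2$, also regarded as a power series in $r$ variables. Then $$\theta_h=1+2^r w\,\theta_g .$$ -/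

import Mathlib

/-- The ideal `(x_i ^ q : i ∈ σ) + (f)` of `F[[x_i : i ∈ σ]]`, where `q = 2 ^ n`. -/
noncomputable def hilbertKunzIdeal {σ F : Type*} [Field F] (f : MvPowerSeries σ F) (n : ℕ) :
    Ideal (MvPowerSeries σ F) :=
  Ideal.span (Set.range fun i : σ => (MvPowerSeries.X i : MvPowerSeries σ F) ^ (2 ^ n)) ⊔
    Ideal.span {f}

/-- The Hilbert-Kunz function `n ↦ e_n(f)` of a power series `f` over a field of characteristic 2:
`e_n(f) = dim_F F[[x_i]] / (x_i ^ q, f)` with `q = 2 ^ n`. For finitely many variables the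
quotient is finite-dimensional (it is spanned by the classes of the monomials all of whose
exponents are `< q`), so that `Module.finrank` is the true dimension. -/
noncomputable def hilbertKunz {σ F : Type*} [Field F] (f : MvPowerSeries σ F) (n : ℕ) : ℕ :=
  Module.finrank F (MvPowerSeries σ F ⧸ hilbertKunzIdeal f n)

/-- The power series `G = uv + g` in `r + 2` variables attached to a power series `g` in `r`
variables; the two new variables are `u = X (Sum.inr 0)` and `v = X (Sum.inr 1)`. -/
noncomputable def uvAdd {r : ℕ} {F : Type*} [Field F] (g : MvPowerSeries (Fin r) F) :
    MvPowerSeries (Fin r ⊕ Fin 2) F :=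
  MvPowerSeries.X (Sum.inr 0) * MvPowerSeries.X (Sum.inr 1) +
    MvPowerSeries.rename (Sum.inl : Fin r → Fin r ⊕ Fin 2) g

/-- `θ_g = (1 - 2 ^ (r + 1) w) * ∑ n, e_n(uv + g) w ^ n` in `ℤ[[w]]`. -/
noncomputable def hkTheta {r : ℕ} {F : Type*} [Field F] (g : MvPowerSeries (Fin r) F) :
    PowerSeries ℤ :=
  (1 - PowerSeries.C ((2 : ℤ) ^ (r + 1)) * PowerSeries.X) *
    PowerSeries.mk fun n => (hilbertKunz (uvAdd g) n : ℤ)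

/-! Write D_q(f) for the dimension of F[[x]]/(x_i^q, f), which is `powDim f q`.

Modulo uv + g, multiplication by uv is multiplication by -g. Sort the monomials u^i v^j with i, j <
q into diagonals i - j = constant. A diagonal starts at some (a, b) with a = 0 or b = 0 and has
length L = q - a - b, so it contributes F[[x]]/(x^q, g^L). The length q occurs once and each smaller
positive length twice. For q = 2^n, g^q lies in (x^q), so D_q(g^q) = q^r and e_n(uv + g) + q^r = 2
∑_{k=1}^q D_q(g^k) (`powDim_uvPlus_eq_sum`, `powDim_uvPlus`).

Frobenius gives D_{2q}(f^2) = 2^r D_q(f) (`powDim_pow_char`). Apply the formula to h = g^2 at level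
2q: the terms k ≤ q reproduce 2^r times the sum for g, and each term k > q equals 2^r q^r. Hence
e_{n+1}(uv + h) = 2^r e_n(uv + g) + 2^((n+1)(r+1)), with e_0 = 1. In the generating function the
last summand is a geometric series, which the factor 1 - 2^(r+1) w turns into 1. -/

/-- A finite decomposition of a module, up to submodules, gives a decomposition of quotients. -/
theorem finrank_quotient_eq_sum {F A B ι : Type*} [Field F] [CommRing A] [Algebra F A]
    [CommRing B] [Algebra F B] [Fintype ι] [DecidableEq ι] (I : Ideal A) (K : ι → Ideal B)
    [∀ s, Module.Finite F (B ⧸ K s)]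
    (T : ι → A →ₗ[F] B) (E : ι → B → A)
    (hT : ∀ s, ∀ x ∈ I, T s x ∈ K s) (hE : ∀ s, ∀ y ∈ K s, E s y ∈ I)
    (hTE : ∀ s t y, T s (E t y) = if s = t then y else 0)
    (hET : ∀ x, x - ∑ s, E s (T s x) ∈ I) :
    Module.finrank F (A ⧸ I) = ∑ s, Module.finrank F (B ⧸ K s) := by
  let Φ : A →ₗ[F] (∀ s, B ⧸ K s) :=
    LinearMap.pi fun s => (Ideal.Quotient.mkₐ F (K s)).toLinearMap ∘ₗ T s
  have hΦ : ∀ x s, Φ x s = Ideal.Quotient.mk (K s) (T s x) := fun x s => rfl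
  have hsurj : Function.Surjective Φ := by
    intro y
    choose z hz using fun s => Ideal.Quotient.mk_surjective (y s)
    refine ⟨∑ t, E t (z t), ?_⟩
    funext s
    rw [hΦ, map_sum]
    simp [hTE, hz]
  have hker : LinearMap.ker Φ = I.restrictScalars F := by
    ext x
    simp only [LinearMap.mem_ker, Submodule.restrictScalars_mem]
    constructor
    · intro h
      have h1 : ∑ s, E s (T s x) ∈ I := Ideal.sum_mem _ fun s _ => hE s _ (by
        rw [← Ideal.Quotient.eq_zero_iff_mem, ← hΦ, h]; rfl)
      simpa using I.add_mem (hET x) h1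
    · intro h
      funext s
      rw [hΦ]
      exact Ideal.Quotient.eq_zero_iff_mem.2 (hT s x h)
  have e : (A ⧸ I) ≃ₗ[F] (∀ s, B ⧸ K s) :=
    (Submodule.Quotient.restrictScalarsEquiv F I).symm ≪≫ₗ
      (Submodule.quotEquivOfEq _ _ hker.symm) ≪≫ₗ Φ.quotKerEquivOfSurjective hsurj
  rw [e.finrank_eq, Module.finrank_pi_fintype]

/-- Transvections reduce M to a diagonal matrix and stay invertible under φ; the rank then counts
nonzero diagonal entries, which the injective φ preserves. -/
theorem Matrix.rank_map_of_field {m F K : Type*} [Fintype m] [DecidableEq m] [Field F] [Field K]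
    (φ : F →+* K) (M : Matrix m m F) : (M.map φ).rank = M.rank := by
  classical
  obtain ⟨L, L', D, h⟩ := Matrix.Pivot.exists_list_transvec_mul_diagonal_mul_list_transvec M
  set U := (L.map Matrix.TransvectionStruct.toMatrix).prod
  set V := (L'.map Matrix.TransvectionStruct.toMatrix).prod
  have hU : U.det = 1 := Matrix.TransvectionStruct.det_toMatrix_prod L
  have hV : V.det = 1 := Matrix.TransvectionStruct.det_toMatrix_prod L'
  have hU' : (U.map φ).det = 1 := by
    have := φ.map_det U
    rw [hU, map_one] at this
    exact this.symm
  have hV' : (V.map φ).det = 1 := by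
    have := φ.map_det V
    rw [hV, map_one] at this
    exact this.symm
  rw [h, Matrix.map_mul, Matrix.map_mul,
    Matrix.rank_mul_eq_left_of_isUnit_det _ _ (by rw [hV']; exact isUnit_one),
    Matrix.rank_mul_eq_right_of_isUnit_det _ _ (by rw [hU']; exact isUnit_one),
    Matrix.rank_mul_eq_left_of_isUnit_det _ _ (by rw [hV]; exact isUnit_one),
    Matrix.rank_mul_eq_right_of_isUnit_det _ _ (by rw [hU]; exact isUnit_one),
    Matrix.diagonal_map (map_zero φ), Matrix.rank_diagonal, Matrix.rank_diagonal]
  simp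

/-! ### Quotients by q-th powers of the variables and one series, as matrix cokernels -/

namespace MvPowerSeries

variable {σ τ F : Type*} [Field F]

variable (σ F) in
/-- The ideal generated by the `q`-th powers of the variables. -/
noncomputable def powIdeal (q : ℕ) : Ideal (MvPowerSeries σ F) :=
  Ideal.span (Set.range fun i : σ => (X i : MvPowerSeries σ F) ^ q)

theorem X_pow_mem_powIdeal (q : ℕ) (i : σ) : (X i : MvPowerSeries σ F) ^ q ∈ powIdeal σ F q :=
  Ideal.subset_span ⟨i, rfl⟩

/-- The dimension of `F⟦σ⟧ / (xᵢ ^ q, f)`. -/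
noncomputable def powDim (f : MvPowerSeries σ F) (q : ℕ) : ℕ :=
  Module.finrank F (MvPowerSeries σ F ⧸ powIdeal σ F q ⊔ Ideal.span {f})

theorem hilbertKunz_eq_powDim (f : MvPowerSeries σ F) (n : ℕ) :
    hilbertKunz f n = powDim f (2 ^ n) := rfl

/-- T is only F-linear, so it has to be tested on all multiples of the generators, not just on the
generators. -/
theorem map_mem_of_mem_powIdeal_sup [Finite τ] {f : MvPowerSeries τ F} {q : ℕ}
    (T : MvPowerSeries τ F →ₗ[F] MvPowerSeries σ F) {K : Ideal (MvPowerSeries σ F)}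
    (hX : ∀ i c, T (X i ^ q * c) ∈ K) (hf : ∀ c, T (f * c) ∈ K) {x : MvPowerSeries τ F}
    (hx : x ∈ powIdeal τ F q ⊔ Ideal.span {f}) : T x ∈ K := by
  have := Fintype.ofFinite τ
  obtain ⟨y, hy, z, hz, rfl⟩ := Submodule.mem_sup.1 hx
  obtain ⟨c, rfl⟩ := Ideal.mem_span_range_iff_exists_fun.1 hy
  obtain ⟨d, rfl⟩ := Ideal.mem_span_singleton'.1 hz
  rw [map_add, map_sum]
  refine K.add_mem (Ideal.sum_mem _ fun i _ => ?_) ?_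
  · rw [mul_comm]; exact hX _ _
  · rw [mul_comm]; exact hf _

theorem mem_powIdeal_of_coeff [Finite σ] {q : ℕ} {f : MvPowerSeries σ F}
    (h : ∀ m : σ →₀ ℕ, (∀ i, m i < q) → coeff m f = 0) : f ∈ powIdeal σ F q := by
  classical
  have := Fintype.ofFinite σ
  suffices H : ∀ (S : Finset σ) (f : MvPowerSeries σ F),
      (∀ m : σ →₀ ℕ, (∀ i ∈ S, m i < q) → coeff m f = 0) → f ∈ powIdeal σ F q by
    exact H Finset.univ f fun m hm => h m fun i => hm i (Finset.mem_univ i)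
  intro S
  induction S using Finset.induction_on with
  | empty =>
    intro f hf
    have : f = 0 := by ext m; simpa using hf m (by simp)
    rw [this]; exact Ideal.zero_mem _
  | insert a S _ ih =>
    intro f hf
    -- The terms of f divisible by x_a^q; removing them disposes of the variable a.
    let f₁ : MvPowerSeries σ F := fun m => if q ≤ m a then coeff m f else 0
    have hf₁ : ∀ m, coeff m f₁ = if q ≤ m a then coeff m f else 0 := fun m => rfl
    have h₁ : f₁ ∈ powIdeal σ F q := by
      have : X a ^ q ∣ f₁ := X_pow_dvd_iff.2 fun m hm => by rw [hf₁, if_neg (by omega)]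
      exact Ideal.mem_of_dvd _ this (X_pow_mem_powIdeal q a)
    have h₂ : f - f₁ ∈ powIdeal σ F q := by
      refine ih _ fun m hm => ?_
      rw [map_sub, hf₁]
      split_ifs with hq
      · simp
      · rw [hf m, sub_zero]
        intro i hi
        rcases Finset.mem_insert.1 hi with rfl | hi
        · omega
        · exact hm i hi
    simpa using Ideal.add_mem _ h₂ h₁

theorem coeff_eq_zero_of_mem_powIdeal [Finite σ] {q : ℕ} {f : MvPowerSeries σ F}
    (hf : f ∈ powIdeal σ F q) {m : σ →₀ ℕ} (hm : ∀ i, m i < q) : coeff m f = 0 := by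
  have := Fintype.ofFinite σ
  obtain ⟨c, rfl⟩ := Ideal.mem_span_range_iff_exists_fun.1 hf
  rw [map_sum]
  refine Finset.sum_eq_zero fun i _ => ?_
  exact X_pow_dvd_iff.1 (Dvd.intro_left (c i) rfl) m (hm i)

section Box

variable [Fintype σ]

/-- The exponent vector of an element of the box `[0, q) ^ σ`. -/
noncomputable def boxExp {q : ℕ} (a : σ → Fin q) : σ →₀ ℕ :=
  Finsupp.equivFunOnFinite.symm fun i => (a i : ℕ)

@[simp] theorem boxExp_apply {q : ℕ} (a : σ → Fin q) (i : σ) : boxExp a i = a i := rfl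

theorem boxExp_injective {q : ℕ} : Function.Injective (boxExp : (σ → Fin q) → σ →₀ ℕ) := by
  intro a b h
  funext i
  exact Fin.ext (by simpa using DFunLike.congr_fun h i)

variable (σ F) in
/-- The coefficients of a power series with exponents in the box `[0, q) ^ σ`. -/
noncomputable def boxCoeff (q : ℕ) : MvPowerSeries σ F →ₗ[F] ((σ → Fin q) → F) :=
  LinearMap.pi fun a => coeff (boxExp a)

theorem boxCoeff_apply {q : ℕ} (f : MvPowerSeries σ F) (a : σ → Fin q) :
    boxCoeff σ F q f a = coeff (boxExp a) f := rfl

theorem boxCoeff_eq_zero_iff {q : ℕ} {f : MvPowerSeries σ F} :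
    boxCoeff σ F q f = 0 ↔ f ∈ powIdeal σ F q := by
  constructor
  · intro h
    refine mem_powIdeal_of_coeff fun m hm => ?_
    have := congrFun h fun i => ⟨m i, hm i⟩
    rw [boxCoeff_apply] at this
    have e : boxExp (fun i => (⟨m i, hm i⟩ : Fin q)) = m := by ext i; rfl
    rwa [e] at this
  · intro h
    funext a
    exact coeff_eq_zero_of_mem_powIdeal h fun i => (a i).2

variable [DecidableEq σ]

theorem boxCoeff_surjective (q : ℕ) : Function.Surjective (boxCoeff σ F q) := by
  intro c
  refine ⟨∑ a, monomial (boxExp a) (c a), ?_⟩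
  funext b
  rw [boxCoeff_apply, map_sum, Finset.sum_eq_single b]
  · simp
  · intro a _ hab
    exact coeff_monomial_ne (fun h => hab (boxExp_injective h.symm)) _
  · simp

/-- The matrix of multiplication by `f` modulo the `q`-th powers of the variables. -/
noncomputable def boxMatrix (f : MvPowerSeries σ F) (q : ℕ) :
    Matrix (σ → Fin q) (σ → Fin q) F :=
  fun a b => open Classical in if boxExp b ≤ boxExp a then coeff (boxExp a - boxExp b) f else 0

/-- The box is closed under passing to smaller exponents, so the box coefficients of a product
involve only box coefficients of P. -/
theorem boxCoeff_mul (f P : MvPowerSeries σ F) (q : ℕ) :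
    boxCoeff σ F q (f * P) = (boxMatrix f q).mulVec (boxCoeff σ F q P) := by
  classical
  funext a
  rw [boxCoeff_apply, coeff_mul, Matrix.mulVec, dotProduct]
  simp only [boxMatrix, ite_mul, zero_mul, ← Finset.sum_filter]
  symm
  refine Finset.sum_of_injOn (fun b => (boxExp a - boxExp b, boxExp b)) ?_ ?_ ?_ ?_
  · intro b _ c _ h
    exact boxExp_injective (Prod.ext_iff.1 h).2
  · intro b hb
    simp only [Finset.coe_filter, Finset.mem_univ, true_and, Set.mem_ofPred_eq] at hb
    simp [tsub_add_cancel_of_le hb]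
  · rintro ⟨x, y⟩ hxy hn
    exfalso
    apply hn
    have hxy' : x + y = boxExp a := by simpa using hxy
    have hy : y ≤ boxExp a := by rw [← hxy']; exact le_add_self
    have e : boxExp (fun i => (⟨y i, lt_of_le_of_lt (hy i) (a i).2⟩ : Fin q)) = y := by ext i; rfl
    refine ⟨fun i => ⟨y i, lt_of_le_of_lt (hy i) (a i).2⟩, ?_, ?_⟩
    · simpa [e] using hy
    · simp [e, ← hxy']
  · intro b _
    rfl

theorem mem_powIdeal_sup_iff (f P : MvPowerSeries σ F) (q : ℕ) :
    P ∈ powIdeal σ F q ⊔ Ideal.span {f} ↔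
      boxCoeff σ F q P ∈ LinearMap.range (boxMatrix f q).mulVecLin := by
  constructor
  · intro h
    obtain ⟨y, hy, z, hz, rfl⟩ := Submodule.mem_sup.1 h
    obtain ⟨d, rfl⟩ := Ideal.mem_span_singleton'.1 hz
    refine ⟨boxCoeff σ F q d, ?_⟩
    rw [map_add, boxCoeff_eq_zero_iff.2 hy, zero_add, mul_comm, boxCoeff_mul]
    rfl
  · rintro ⟨c, hc⟩
    obtain ⟨d, rfl⟩ := boxCoeff_surjective (F := F) q c
    rw [Matrix.mulVecLin_apply, ← boxCoeff_mul] at hc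
    have : P - f * d ∈ powIdeal σ F q := by
      rw [← boxCoeff_eq_zero_iff, map_sub, hc, sub_self]
    rw [← sub_add_cancel P (f * d)]
    exact Submodule.add_mem_sup this (Ideal.mul_mem_right _ _ (Ideal.mem_span_singleton_self f))

/-- The quotient `F⟦σ⟧ / (xᵢ ^ q, f)` is the cokernel of the matrix of multiplication by `f`. -/
noncomputable def quotientEquiv (f : MvPowerSeries σ F) (q : ℕ) :
    (MvPowerSeries σ F ⧸ powIdeal σ F q ⊔ Ideal.span {f}) ≃ₗ[F]
      ((σ → Fin q) → F) ⧸ LinearMap.range (boxMatrix f q).mulVecLin :=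
  (Submodule.Quotient.restrictScalarsEquiv F _).symm ≪≫ₗ
    Submodule.quotEquivOfEq _ (LinearMap.ker
      ((LinearMap.range (boxMatrix f q).mulVecLin).mkQ ∘ₗ boxCoeff σ F q)) (by
        ext P
        rw [LinearMap.mem_ker, LinearMap.comp_apply, Submodule.mkQ_apply,
          Submodule.Quotient.mk_eq_zero, Submodule.restrictScalars_mem, mem_powIdeal_sup_iff]) ≪≫ₗ
    LinearMap.quotKerEquivOfSurjective _
      ((Submodule.mkQ_surjective _).comp (boxCoeff_surjective q))

end Box

instance finite_quotient [Finite σ] (f : MvPowerSeries σ F) (q : ℕ) :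
    Module.Finite F (MvPowerSeries σ F ⧸ powIdeal σ F q ⊔ Ideal.span {f}) := by
  classical
  have := Fintype.ofFinite σ
  exact Module.Finite.equiv (quotientEquiv f q).symm

theorem powDim_add_rank [Fintype σ] [DecidableEq σ] (f : MvPowerSeries σ F) (q : ℕ) :
    powDim f q + (boxMatrix f q).rank = q ^ Fintype.card σ := by
  rw [powDim, (quotientEquiv f q).finrank_eq, Matrix.rank,
    Submodule.finrank_quotient_add_finrank]
  simp

/-- Needed for the Frobenius of F, which need not be surjective: the dimension is read off from a
matrix rank, which field extension does not change. -/
theorem powDim_map [Finite σ] {K : Type*} [Field K] (φ : F →+* K) (f : MvPowerSeries σ F) (q : ℕ) :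
    powDim (map φ f) q = powDim f q := by
  classical
  have := Fintype.ofFinite σ
  have h : boxMatrix (map φ f) q = (boxMatrix f q).map φ := by
    ext a b
    simp only [boxMatrix, Matrix.map_apply, coeff_map]
    split_ifs <;> simp
  have h₁ := powDim_add_rank (map φ f) q
  have h₂ := powDim_add_rank f q
  rw [h, Matrix.rank_map_of_field] at h₁
  omega

theorem powDim_of_mem [Fintype σ] {f : MvPowerSeries σ F} {q : ℕ} (hf : f ∈ powIdeal σ F q) :
    powDim f q = q ^ Fintype.card σ := by
  classical
  have h : boxMatrix f q = 0 := by
    ext a b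
    simp only [boxMatrix, Matrix.zero_apply]
    split_ifs with hab
    · exact coeff_eq_zero_of_mem_powIdeal hf fun i => by
        simpa using lt_of_le_of_lt (Nat.sub_le _ _) (a i).2
    · rfl
  rw [← powDim_add_rank f q, h, Matrix.rank_zero, add_zero]

/-! ### Coefficient slices and the variables u, v -/

/-- The power series formed by the coefficients of `P` at the exponents `φ m + e`. -/
noncomputable def slice (φ : (σ →₀ ℕ) → (τ →₀ ℕ)) (e : τ →₀ ℕ) :
    MvPowerSeries τ F →ₗ[F] MvPowerSeries σ F where
  toFun P := fun m => coeff (φ m + e) P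
  map_add' _ _ := rfl
  map_smul' _ _ := rfl

theorem coeff_slice (φ : (σ →₀ ℕ) → (τ →₀ ℕ)) (e : τ →₀ ℕ) (P : MvPowerSeries τ F) (m : σ →₀ ℕ) :
    coeff m (slice φ e P) = coeff (φ m + e) P := rfl

/-- Q is p with its exponents transported by φ. By `hle`, a splitting of φ m + e whose first part
lies in the range of φ comes from a splitting of m. Serves both for adjoining u, v and for x ↦ x^p.
-/
theorem slice_mul (φ : (σ →₀ ℕ) →+ (τ →₀ ℕ)) (hφ : Function.Injective φ) {e : τ →₀ ℕ}
    (hle : ∀ a m, φ a ≤ φ m + e → a ≤ m) {p : MvPowerSeries σ F} {Q : MvPowerSeries τ F}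
    (hQ : ∀ x, coeff (φ x) Q = coeff x p) (hQ0 : ∀ y, y ∉ Set.range φ → coeff y Q = 0)
    (P : MvPowerSeries τ F) : slice φ e (Q * P) = p * slice φ e P := by
  classical
  ext m
  rw [coeff_slice, coeff_mul, coeff_mul]
  symm
  refine Finset.sum_of_injOn (fun x => (φ x.1, φ x.2 + e)) ?_ ?_ ?_ ?_
  · rintro ⟨a, b⟩ _ ⟨c, d⟩ _ h
    simp only [Prod.mk.injEq, add_left_inj] at h
    exact Prod.ext (hφ h.1) (hφ h.2)
  · rintro ⟨a, b⟩ h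
    have h : a + b = m := by simpa using h
    simp [← h, add_assoc]
  · rintro ⟨x, y⟩ hxy hn
    by_cases hx : x ∈ Set.range φ
    · exfalso
      apply hn
      obtain ⟨a, rfl⟩ := hx
      have hxy : φ a + y = φ m + e := by simpa using hxy
      have ham : a ≤ m := hle a m (by rw [← hxy]; exact le_self_add)
      refine ⟨(a, m - a), by simpa using add_tsub_cancel_of_le ham, ?_⟩
      refine Prod.ext rfl (add_left_cancel (a := φ a) ?_)
      rw [hxy, ← add_assoc, ← map_add, add_tsub_cancel_of_le ham]
    · rw [hQ0 _ hx, zero_mul]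
  · rintro ⟨a, b⟩ _
    rw [coeff_slice, hQ]

variable (σ) in
/-- The exponent vector of `u ^ a * v ^ b`. -/
noncomputable def uvExp (a b : ℕ) : σ ⊕ Fin 2 →₀ ℕ :=
  Finsupp.single (Sum.inr 0) a + Finsupp.single (Sum.inr 1) b

@[simp] theorem uvExp_inl (a b : ℕ) (i : σ) : uvExp σ a b (Sum.inl i) = 0 := by simp [uvExp]

@[simp] theorem uvExp_inr_zero (a b : ℕ) : uvExp σ a b (Sum.inr 0) = a := by simp [uvExp]

@[simp] theorem uvExp_inr_one (a b : ℕ) : uvExp σ a b (Sum.inr 1) = b := by simp [uvExp]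

theorem uvExp_add (a b c d : ℕ) : uvExp σ a b + uvExp σ c d = uvExp σ (a + c) (b + d) := by
  simp only [uvExp, Finsupp.single_add]
  abel

variable (σ) in
/-- The inclusion of the exponents of `F⟦σ⟧` into those of `F⟦σ, u, v⟧`. -/
noncomputable def inlExp : (σ →₀ ℕ) →+ (σ ⊕ Fin 2 →₀ ℕ) :=
  Finsupp.mapDomain.addMonoidHom Sum.inl

theorem inlExp_injective : Function.Injective (inlExp σ) :=
  Finsupp.mapDomain_injective Sum.inl_injective

@[simp] theorem inlExp_inl (m : σ →₀ ℕ) (i : σ) : inlExp σ m (Sum.inl i) = m i :=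
  Finsupp.mapDomain_apply Sum.inl_injective m i

@[simp] theorem inlExp_inr (m : σ →₀ ℕ) (i : Fin 2) : inlExp σ m (Sum.inr i) = 0 :=
  Finsupp.mapDomain_of_notMem_range m _ (by simp)

theorem exists_eq_inlExp_add_uvExp (x : σ ⊕ Fin 2 →₀ ℕ) :
    ∃ m, x = inlExp σ m + uvExp σ (x (Sum.inr 0)) (x (Sum.inr 1)) := by
  refine ⟨x.comapDomain Sum.inl Sum.inl_injective.injOn, ?_⟩
  ext i
  rcases i with i | i
  · simp
  · fin_cases i <;> simp

variable (F) in
/-- The monomial `u ^ a * v ^ b`. -/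
noncomputable def uvMonomial (σ : Type*) (a b : ℕ) : MvPowerSeries (σ ⊕ Fin 2) F :=
  monomial (uvExp σ a b) 1

theorem uvMonomial_mul (a b c d : ℕ) :
    uvMonomial F σ a b * uvMonomial F σ c d = uvMonomial F σ (a + c) (b + d) := by
  rw [uvMonomial, uvMonomial, monomial_mul_monomial, uvExp_add, one_mul, uvMonomial]

theorem uvMonomial_pow (a b k : ℕ) :
    uvMonomial F σ a b ^ k = uvMonomial F σ (k * a) (k * b) := by
  induction k with
  | zero => simp [uvMonomial, uvExp]
  | succ k ih => rw [pow_succ, ih, uvMonomial_mul, Nat.succ_mul, Nat.succ_mul]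

theorem uvMonomial_eq (a b : ℕ) :
    uvMonomial F σ a b = X (Sum.inr 0) ^ a * X (Sum.inr 1) ^ b := by
  rw [X_pow_eq, X_pow_eq, monomial_mul_monomial, one_mul]
  rfl

theorem uvMonomial_mem_powIdeal {a b q : ℕ} (h : q ≤ a ∨ q ≤ b) :
    uvMonomial F σ a b ∈ powIdeal (σ ⊕ Fin 2) F q := by
  rw [uvMonomial_eq]
  rcases h with h | h
  · exact Ideal.mul_mem_right _ _ (Ideal.mem_of_dvd _ (pow_dvd_pow _ h) (X_pow_mem_powIdeal q _))
  · exact Ideal.mul_mem_left _ _ (Ideal.mem_of_dvd _ (pow_dvd_pow _ h) (X_pow_mem_powIdeal q _))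

/-- The coefficient of `u ^ a * v ^ b`. -/
noncomputable def uvCoeff (a b : ℕ) : MvPowerSeries (σ ⊕ Fin 2) F →ₗ[F] MvPowerSeries σ F :=
  slice (inlExp σ) (uvExp σ a b)

theorem coeff_uvCoeff (a b : ℕ) (P : MvPowerSeries (σ ⊕ Fin 2) F) (m : σ →₀ ℕ) :
    coeff m (uvCoeff a b P) = coeff (inlExp σ m + uvExp σ a b) P := rfl

theorem uvCoeff_uvMonomial_mul (a b c d : ℕ) (P : MvPowerSeries (σ ⊕ Fin 2) F) :
    uvCoeff a b (uvMonomial F σ c d * P) =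
      if c ≤ a ∧ d ≤ b then uvCoeff (a - c) (b - d) P else 0 := by
  classical
  ext m
  have hle : uvExp σ c d ≤ inlExp σ m + uvExp σ a b ↔ c ≤ a ∧ d ≤ b := by
    constructor
    · intro h
      exact ⟨by simpa using h (Sum.inr 0), by simpa using h (Sum.inr 1)⟩
    · rintro ⟨h₁, h₂⟩ (i | i)
      · simp
      · fin_cases i <;> simpa
  rw [coeff_uvCoeff, uvMonomial, coeff_monomial_mul]
  by_cases h : c ≤ a ∧ d ≤ b
  · rw [if_pos (hle.2 h), if_pos h, one_mul, coeff_uvCoeff]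
    congr 1
    obtain ⟨a', rfl⟩ := Nat.exists_eq_add_of_le h.1
    obtain ⟨b', rfl⟩ := Nat.exists_eq_add_of_le h.2
    rw [← uvExp_add, add_tsub_cancel_left, add_tsub_cancel_left, add_left_comm,
      add_tsub_cancel_left]
  · rw [if_neg (mt hle.1 h), if_neg h, map_zero]

theorem uvCoeff_X_pow_mul {a b q : ℕ} (ha : a < q) (hb : b < q) (i : Fin 2)
    (P : MvPowerSeries (σ ⊕ Fin 2) F) : uvCoeff a b (X (Sum.inr i) ^ q * P) = 0 := by
  ext m
  rw [coeff_uvCoeff, map_zero]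
  refine X_pow_dvd_iff.1 (Dvd.intro P rfl) _ ?_
  fin_cases i <;> simpa

/-! ### Decomposition of the quotient by uv + g along diagonals -/

/-- The exponents of the monomials in `u` and `v` that are not divisible by `uv`. -/
def uvStart {q : ℕ} : Fin q ⊕ Fin (q - 1) → ℕ × ℕ :=
  Sum.elim (fun k => (k, 0)) (fun k => (0, k + 1))

theorem uvStart_injective {q : ℕ} : Function.Injective (uvStart (q := q)) := by
  rintro (a | a) (b | b) h <;> simp [uvStart, Fin.ext_iff] at h ⊢ <;> omega

theorem uvStart_spec {q : ℕ} (s : Fin q ⊕ Fin (q - 1)) :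
    (uvStart s).1 + (uvStart s).2 < q ∧ ((uvStart s).1 = 0 ∨ (uvStart s).2 = 0) := by
  rcases s with ⟨k, hk⟩ | ⟨k, hk⟩ <;> simp [uvStart] <;> omega

/-- The q × q square is the disjoint union of its diagonals; the one starting at (a, b) leaves the
square after q - a - b steps. -/
theorem sum_uvStart {M : Type*} [AddCommMonoid M] (q : ℕ) (f : ℕ → ℕ → M) :
    ∑ s : Fin q ⊕ Fin (q - 1), ∑ j ∈ Finset.range (q - (uvStart s).1 - (uvStart s).2),
      f ((uvStart s).1 + j) ((uvStart s).2 + j) =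
    ∑ i ∈ Finset.range q, ∑ j ∈ Finset.range q, f i j := by
  rw [Fintype.sum_sum_type]
  simp only [uvStart, Sum.elim_inl, Sum.elim_inr]
  rw [Fin.sum_univ_eq_sum_range (fun k => ∑ j ∈ Finset.range (q - k - 0), f (k + j) (0 + j)),
    Fin.sum_univ_eq_sum_range
      (fun k => ∑ j ∈ Finset.range (q - 0 - (k + 1)), f (0 + j) (k + 1 + j)),
    Finset.sum_sigma', Finset.sum_sigma', ← Finset.sum_product',
    ← Finset.sum_filter_add_sum_filter_not (Finset.range q ×ˢ Finset.range q)
      (fun p => p.2 ≤ p.1)]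
  congr 1
  · refine Finset.sum_nbij' (fun x => (x.1 + x.2, x.2)) (fun p => ⟨p.1 - p.2, p.2⟩) ?_ ?_ ?_ ?_ ?_
    · rintro ⟨k, j⟩ h
      simp at h ⊢
      omega
    · rintro ⟨k, j⟩ h
      simp at h ⊢
      omega
    · rintro ⟨k, j⟩ _
      simp
    · rintro ⟨k, j⟩ h
      simp at h ⊢
      omega
    · rintro ⟨k, j⟩ _
      simp
  · refine Finset.sum_nbij' (fun x => (x.2, x.1 + 1 + x.2)) (fun p => ⟨p.2 - p.1 - 1, p.1⟩)
      ?_ ?_ ?_ ?_ ?_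
    · rintro ⟨k, j⟩ h
      simp at h ⊢
      omega
    · rintro ⟨k, j⟩ h
      simp at h ⊢
      omega
    · rintro ⟨k, j⟩ _
      simp
    · rintro ⟨k, j⟩ h
      simp at h ⊢
      omega
    · rintro ⟨k, j⟩ _
      simp

/-- The component of `F⟦σ, u, v⟧ / (uv + g)` along `u ^ a * v ^ b`. -/
noncomputable def uvComponent (g : MvPowerSeries σ F) (a b L : ℕ) :
    MvPowerSeries (σ ⊕ Fin 2) F →ₗ[F] MvPowerSeries σ F :=
  ∑ j ∈ Finset.range L, LinearMap.mulLeft F ((-g) ^ j) ∘ₗ uvCoeff (a + j) (b + j)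

theorem uvComponent_apply (g : MvPowerSeries σ F) (a b L : ℕ) (P : MvPowerSeries (σ ⊕ Fin 2) F) :
    uvComponent g a b L P = ∑ j ∈ Finset.range L, (-g) ^ j * uvCoeff (a + j) (b + j) P := by
  simp [uvComponent]

section Finite

variable [Finite σ]

theorem coeff_inlExp_rename (p : MvPowerSeries σ F) (x : σ →₀ ℕ) :
    coeff (inlExp σ x) (rename (Sum.inl : σ → σ ⊕ Fin 2) p) = coeff x p := by
  have := coeff_embDomain_rename (⟨Sum.inl, Sum.inl_injective⟩ : σ ↪ σ ⊕ Fin 2) p x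
  rw [Finsupp.embDomain_eq_mapDomain] at this
  exact this

theorem coeff_rename_of_notMem_range_inlExp (p : MvPowerSeries σ F) (y : σ ⊕ Fin 2 →₀ ℕ)
    (hy : y ∉ Set.range (inlExp σ)) :
    coeff y (rename (Sum.inl : σ → σ ⊕ Fin 2) p) = 0 :=
  coeff_rename_eq_zero _ p hy

theorem uvCoeff_rename_mul (a b : ℕ) (p : MvPowerSeries σ F) (P : MvPowerSeries (σ ⊕ Fin 2) F) :
    uvCoeff a b (rename Sum.inl p * P) = p * uvCoeff a b P :=
  slice_mul (inlExp σ) inlExp_injective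
    (fun x m h i => by simpa using h (Sum.inl i)) (coeff_inlExp_rename p)
    (coeff_rename_of_notMem_range_inlExp p) P

theorem uvCoeff_rename (a b : ℕ) (p : MvPowerSeries σ F) :
    uvCoeff a b (rename Sum.inl p) = if a = 0 ∧ b = 0 then p else 0 := by
  ext m
  rw [coeff_uvCoeff]
  split_ifs with h
  · rw [h.1, h.2, show uvExp σ 0 0 = 0 by simp [uvExp], add_zero, coeff_inlExp_rename]
  · rw [map_zero]
    refine coeff_rename_of_notMem_range_inlExp p _ ?_
    rintro ⟨y, hy⟩
    exact h ⟨by simpa using (DFunLike.congr_fun hy (Sum.inr 0)).symm,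
      by simpa using (DFunLike.congr_fun hy (Sum.inr 1)).symm⟩

theorem uvCoeff_uvMonomial_mul_rename (a b c d : ℕ) (p : MvPowerSeries σ F) :
    uvCoeff a b (uvMonomial F σ c d * rename Sum.inl p) = if a = c ∧ b = d then p else 0 := by
  rw [uvCoeff_uvMonomial_mul, uvCoeff_rename]
  split_ifs <;> first | rfl | omega

theorem sub_sum_uvMonomial_mem (q : ℕ) (P : MvPowerSeries (σ ⊕ Fin 2) F) :
    P - ∑ i ∈ Finset.range q, ∑ j ∈ Finset.range q,
      uvMonomial F σ i j * rename Sum.inl (uvCoeff i j P) ∈ powIdeal (σ ⊕ Fin 2) F q := by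
  refine mem_powIdeal_of_coeff fun x hx => ?_
  obtain ⟨m, hm⟩ := exists_eq_inlExp_add_uvExp x
  have ha := hx (Sum.inr 0)
  have hb := hx (Sum.inr 1)
  generalize x (Sum.inr 0) = a at *
  generalize x (Sum.inr 1) = b at *
  rw [hm, ← coeff_uvCoeff, map_sub]
  simp only [map_sum, uvCoeff_uvMonomial_mul_rename]
  rw [Finset.sum_eq_single a, Finset.sum_eq_single b]
  · simp
  · intro j _ hj
    simp [hj.symm]
  · intro h
    exact absurd (Finset.mem_range.2 hb) h
  · intro i _ hi
    simp [hi.symm]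
  · intro h
    exact absurd (Finset.mem_range.2 ha) h

/-- `uv + g` over an arbitrary set of variables of `g`. -/
noncomputable def uvPlus (g : MvPowerSeries σ F) : MvPowerSeries (σ ⊕ Fin 2) F :=
  uvMonomial F σ 1 1 + rename Sum.inl g

/-- The sum telescopes: the shift by uv in term j + 1 cancels the multiplication by g in term j.
Term 0 has no shift because the diagonal starts on the boundary, so only the last product survives,
a multiple of g^(L+1). -/
theorem uvComponent_uvPlus_mul (g : MvPowerSeries σ F) {a b : ℕ} (h : a = 0 ∨ b = 0) (L : ℕ)
    (P : MvPowerSeries (σ ⊕ Fin 2) F) :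
    uvComponent g a b (L + 1) (uvPlus g * P) =
      g * (-g) ^ L * uvCoeff (a + L) (b + L) P := by
  have key : ∀ j, uvCoeff (a + j) (b + j) (uvPlus g * P) =
      (if 1 ≤ a + j ∧ 1 ≤ b + j then uvCoeff (a + j - 1) (b + j - 1) P else 0) +
        g * uvCoeff (a + j) (b + j) P := fun j => by
    rw [uvPlus, add_mul, map_add, uvCoeff_uvMonomial_mul, uvCoeff_rename_mul]
  induction L with
  | zero =>
    rw [uvComponent_apply, zero_add, Finset.sum_range_one, key, if_neg (by omega)]
    ring
  | succ L ih =>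
    rw [uvComponent_apply] at ih ⊢
    rw [Finset.sum_range_succ, ih, key, if_pos (by omega),
      show a + (L + 1) - 1 = a + L by omega, show b + (L + 1) - 1 = b + L by omega]
    ring

theorem uvMonomial_mul_sub_mem (g : MvPowerSeries σ F) (q a b j : ℕ) :
    uvMonomial F σ (a + j) (b + j) - uvMonomial F σ a b * rename Sum.inl ((-g) ^ j) ∈
      powIdeal (σ ⊕ Fin 2) F q ⊔ Ideal.span {uvPlus g} := by
  have h : uvMonomial F σ 1 1 - rename Sum.inl (-g) = uvPlus g := by
    rw [uvPlus, map_neg, sub_neg_eq_add]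
  have h₁ : uvMonomial F σ (a + j) (b + j) = uvMonomial F σ a b * uvMonomial F σ 1 1 ^ j := by
    rw [uvMonomial_pow, uvMonomial_mul, mul_one]
  rw [h₁, map_pow, ← mul_sub]
  refine Ideal.mul_mem_left _ _ (Ideal.mem_sup_right (Ideal.mem_span_singleton.2 ?_))
  rw [← h]
  exact sub_dvd_pow_sub_pow _ _ j

theorem powDim_uvPlus_eq_sum (g : MvPowerSeries σ F) (q : ℕ) :
    powDim (uvPlus g) q = ∑ s : Fin q ⊕ Fin (q - 1),
      powDim (g ^ (q - (uvStart s).1 - (uvStart s).2)) q := by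
  refine finrank_quotient_eq_sum (F := F) _
    (fun s : Fin q ⊕ Fin (q - 1) =>
      powIdeal σ F q ⊔ Ideal.span {g ^ (q - (uvStart s).1 - (uvStart s).2)})
    (fun s => uvComponent g (uvStart s).1 (uvStart s).2 (q - (uvStart s).1 - (uvStart s).2))
    (fun s y => uvMonomial F σ (uvStart s).1 (uvStart s).2 * rename Sum.inl y) ?_ ?_ ?_ ?_
  · intro s x hx
    obtain ⟨hs₁, hs₂⟩ := uvStart_spec s
    generalize (uvStart s).1 = a at *
    generalize (uvStart s).2 = b at *
    refine map_mem_of_mem_powIdeal_sup _ ?_ ?_ hx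
    · rintro (i | i) c
      · rw [uvComponent_apply]
        refine Ideal.mem_sup_left (Ideal.sum_mem _ fun j _ => Ideal.mul_mem_left _ _ ?_)
        rw [← rename_X (R := F) (Sum.inl : σ → σ ⊕ Fin 2) i, ← map_pow, uvCoeff_rename_mul]
        exact Ideal.mul_mem_right _ _ (X_pow_mem_powIdeal q i)
      · rw [uvComponent_apply, Finset.sum_eq_zero]
        · exact Ideal.zero_mem _
        · intro j hj
          rw [Finset.mem_range] at hj
          rw [uvCoeff_X_pow_mul (by omega) (by omega), mul_zero]
    · intro c
      obtain ⟨L, hL⟩ : ∃ L, q - a - b = L + 1 := ⟨q - a - b - 1, by omega⟩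
      rw [hL, uvComponent_uvPlus_mul g hs₂]
      refine Ideal.mem_sup_right (Ideal.mem_span_singleton.2 (Dvd.dvd.mul_right ?_ _))
      rw [pow_succ', neg_pow]
      exact mul_dvd_mul_left g (Dvd.intro_left _ rfl)
  · intro s y hy
    obtain ⟨hs₁, hs₂⟩ := uvStart_spec s
    generalize (uvStart s).1 = a at *
    generalize (uvStart s).2 = b at *
    refine map_mem_of_mem_powIdeal_sup (LinearMap.mulLeft F (uvMonomial F σ a b) ∘ₗ
      (rename (R := F) (Sum.inl : σ → σ ⊕ Fin 2)).toLinearMap) ?_ ?_ hy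
    · intro i c
      simp only [LinearMap.comp_apply, AlgHom.toLinearMap_apply, LinearMap.mulLeft_apply, map_mul,
        map_pow, rename_X]
      exact Ideal.mem_sup_left (Ideal.mul_mem_left _ _ (Ideal.mul_mem_right _ _
        (X_pow_mem_powIdeal q _)))
    · intro c
      -- Going q - a - b steps along the diagonal raises one exponent to q, since a or b is 0. That
      -- monomial vanishes in the quotient, and therefore so does u^a v^b g^(q-a-b).
      have h₁ := uvMonomial_mul_sub_mem g q a b (q - a - b)
      have h₂ : uvMonomial F σ (a + (q - a - b)) (b + (q - a - b)) ∈
          powIdeal (σ ⊕ Fin 2) F q ⊔ Ideal.span {uvPlus g} :=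
        Ideal.mem_sup_left (uvMonomial_mem_powIdeal (by omega))
      have h₃ := Ideal.mul_mem_left _ ((-1) ^ (q - a - b) * rename Sum.inl c)
        (Ideal.sub_mem _ h₂ h₁)
      rw [sub_sub_cancel] at h₃
      convert h₃ using 1
      simp only [LinearMap.comp_apply, AlgHom.toLinearMap_apply, LinearMap.mulLeft_apply, map_mul,
        map_pow, map_neg]
      rw [neg_pow (rename Sum.inl g)]
      have : ((-1 : MvPowerSeries (σ ⊕ Fin 2) F) ^ (q - a - b)) * (-1) ^ (q - a - b) = 1 := by
        rw [← mul_pow]; simp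
      linear_combination (-uvMonomial F σ a b * rename Sum.inl g ^ (q - a - b) *
        rename Sum.inl c) * this
  · intro s t y
    obtain ⟨hs₁, hs₂⟩ := uvStart_spec s
    obtain ⟨ht₁, ht₂⟩ := uvStart_spec t
    simp only [uvComponent_apply, uvCoeff_uvMonomial_mul_rename]
    -- Both starting points have a zero coordinate, so a proper shift of one is never the other.
    rw [Finset.sum_eq_single 0]
    · by_cases hst : s = t
      · simp [hst]
      · rw [if_neg hst, if_neg, mul_zero]
        intro h
        exact hst (uvStart_injective (Prod.ext h.1 h.2))
    · intro j _ hj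
      rw [if_neg (by omega), mul_zero]
    · intro h
      exact absurd (Finset.mem_range.2 (by omega)) h
  · intro x
    -- Truncate x to exponents of u and v below q, then move each monomial back to the start of its
    -- diagonal using uv ≡ -g.
    have h₁ : x - ∑ s : Fin q ⊕ Fin (q - 1),
        ∑ j ∈ Finset.range (q - (uvStart s).1 - (uvStart s).2),
          uvMonomial F σ ((uvStart s).1 + j) ((uvStart s).2 + j) *
            rename Sum.inl (uvCoeff ((uvStart s).1 + j) ((uvStart s).2 + j) x) ∈
        powIdeal (σ ⊕ Fin 2) F q ⊔ Ideal.span {uvPlus g} := by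
      rw [sum_uvStart q fun i j => uvMonomial F σ i j * rename Sum.inl (uvCoeff i j x)]
      exact Ideal.mem_sup_left (sub_sum_uvMonomial_mem q x)
    rw [← sub_add_sub_cancel x _]
    refine Ideal.add_mem _ h₁ ?_
    rw [← Finset.sum_sub_distrib]
    refine Ideal.sum_mem _ fun s _ => ?_
    rw [uvComponent_apply, map_sum, Finset.mul_sum, ← Finset.sum_sub_distrib]
    refine Ideal.sum_mem _ fun j _ => ?_
    rw [map_mul, ← mul_assoc, ← sub_mul]
    exact Ideal.mul_mem_right _ _ (uvMonomial_mul_sub_mem g q _ _ j)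

end Finite

/-- The longest diagonal occurs only once; the added power of q equals D_q(g^q) and supplies its
missing second copy. -/
theorem powDim_uvPlus [Fintype σ] {g : MvPowerSeries σ F} {q : ℕ} (hq : q ≠ 0)
    (hg : g ^ q ∈ powIdeal σ F q) :
    powDim (uvPlus g) q + q ^ Fintype.card σ =
      2 * ∑ k ∈ Finset.range q, powDim (g ^ (k + 1)) q := by
  obtain ⟨q, rfl⟩ := Nat.exists_eq_succ_of_ne_zero hq
  have h₁ : ∑ k ∈ Finset.range (q + 1), powDim (g ^ (q + 1 - k - 0)) (q + 1) =
      ∑ k ∈ Finset.range (q + 1), powDim (g ^ (k + 1)) (q + 1) := by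
    rw [← Finset.sum_range_reflect]
    refine Finset.sum_congr rfl fun k hk => ?_
    rw [Finset.mem_range] at hk
    congr 2
    omega
  have h₂ : ∑ k ∈ Finset.range q, powDim (g ^ (q + 1 - 0 - (k + 1))) (q + 1) =
      ∑ k ∈ Finset.range q, powDim (g ^ (k + 1)) (q + 1) := by
    rw [← Finset.sum_range_reflect]
    refine Finset.sum_congr rfl fun k hk => ?_
    rw [Finset.mem_range] at hk
    congr 2
    omega
  rw [powDim_uvPlus_eq_sum, Fintype.sum_sum_type]
  simp only [uvStart, Sum.elim_inl, Sum.elim_inr, Nat.succ_eq_add_one] at *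
  rw [Nat.add_sub_cancel]
  rw [Fin.sum_univ_eq_sum_range (fun k => powDim (g ^ (q + 1 - k - 0)) (q + 1)),
    Fin.sum_univ_eq_sum_range (fun k => powDim (g ^ (q + 1 - 0 - (k + 1))) (q + 1)), h₁, h₂,
    ← powDim_of_mem hg, add_assoc, ← Finset.sum_range_succ, two_mul]

/-! ### Frobenius and the substitution x ↦ x^p -/

variable (σ) in
/-- Multiplication of exponents by `p`. -/
noncomputable def smulExp (p : ℕ) : (σ →₀ ℕ) →+ (σ →₀ ℕ) := nsmulAddMonoidHom p

@[simp] theorem smulExp_apply (p : ℕ) (m : σ →₀ ℕ) : smulExp σ p m = p • m := rfl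

theorem coeff_expand_of_notMem_range {p : ℕ} (hp : p ≠ 0) (f : MvPowerSeries σ F) (y : σ →₀ ℕ)
    (hy : y ∉ Set.range (smulExp σ p)) : coeff y (expand p hp f) = 0 := by
  by_contra h
  obtain ⟨m, -, hm⟩ := support_expand_subset p hp f h
  exact hy ⟨m, hm⟩

theorem pow_char_mem_powIdeal (p : ℕ) [hp : Fact p.Prime] [CharP F p] {f : MvPowerSeries σ F} {q : ℕ} (hf : f ∈ powIdeal σ F q) :
    f ^ p ∈ powIdeal σ F (p * q) := by
  have : CharP (MvPowerSeries σ F) p :=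
    charP_of_injective_ringHom (C_injective (σ := σ) (R := F)) p
  have h : powIdeal σ F q ≤ (powIdeal σ F (p * q)).comap (frobenius (MvPowerSeries σ F) p) := by
    rw [powIdeal, Ideal.span_le]
    rintro _ ⟨i, rfl⟩
    change (X i ^ q) ^ p ∈ powIdeal σ F (p * q)
    rw [← pow_mul, mul_comm]
    exact X_pow_mem_powIdeal _ i
  exact h hf

theorem mem_powIdeal_one [Finite σ] {f : MvPowerSeries σ F} (hf : constantCoeff f = 0) :
    f ∈ powIdeal σ F 1 := by
  refine mem_powIdeal_of_coeff fun m hm => ?_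
  have : m = 0 := by ext i; simpa using hm i
  rw [this, coeff_zero_eq_constantCoeff_apply, hf]

section Fintype

variable [Fintype σ]

/-- The exponents congruent to `a` modulo `p`. -/
noncomputable def residueSlice {p : ℕ} (a : σ → Fin p) :
    MvPowerSeries σ F →ₗ[F] MvPowerSeries σ F :=
  slice (smulExp σ p) (boxExp a)

theorem coeff_residueSlice {p : ℕ} (a : σ → Fin p) (P : MvPowerSeries σ F) (m : σ →₀ ℕ) :
    coeff m (residueSlice a P) = coeff (p • m + boxExp a) P := rfl

theorem residueSlice_expand_mul {p : ℕ} (hp : p ≠ 0) (a : σ → Fin p) (f P : MvPowerSeries σ F) :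
    residueSlice a (expand p hp f * P) = f * residueSlice a P := by
  refine slice_mul (smulExp σ p) (nsmul_right_injective hp) (fun x m h i => ?_)
    (coeff_expand_smul p hp f) (coeff_expand_of_notMem_range hp f) P
  have h₁ : p * x i ≤ p * m i + a i := by simpa using h i
  have h₂ := (a i).2
  by_contra h₃
  have : p * (m i + 1) ≤ p * x i := Nat.mul_le_mul_left p (by omega)
  rw [mul_add] at this
  omega

theorem residue_add_eq {p : ℕ} {a b : σ → Fin p} {m n : σ →₀ ℕ}
    (h : p • m + boxExp a = p • n + boxExp b) : a = b ∧ m = n := by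
  have key : ∀ i, p * m i + a i = p * n i + b i := fun i => by
    simpa using DFunLike.congr_fun h i
  have hab : a = b := by
    funext i
    have := congrArg (· % p) (key i)
    simp only [Nat.mul_add_mod, Nat.mod_eq_of_lt (a i).2, Nat.mod_eq_of_lt (b i).2] at this
    exact Fin.ext this
  refine ⟨hab, ?_⟩
  ext i
  have h₁ := key i
  rw [hab, add_left_inj] at h₁
  exact Nat.eq_of_mul_eq_mul_left ((Nat.zero_le _).trans_lt (a i).2) h₁

theorem residueSlice_monomial_mul_expand [DecidableEq σ] {p : ℕ} (hp : p ≠ 0) (a b : σ → Fin p)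
    (f : MvPowerSeries σ F) :
    residueSlice a (monomial (boxExp b) 1 * expand p hp f) = if a = b then f else 0 := by
  classical
  rw [mul_comm, residueSlice_expand_mul]
  have h : residueSlice a (monomial (boxExp b) (1 : F)) = if a = b then 1 else 0 := by
    ext m
    rw [coeff_residueSlice, coeff_monomial]
    have key : p • m + boxExp a = boxExp b ↔ a = b ∧ m = 0 :=
      ⟨fun h => residue_add_eq (n := 0) (by simpa using h), fun h => by simp [h.1, h.2]⟩
    simp only [key]
    by_cases hab : a = b <;> simp [hab, coeff_one]
  rw [h, mul_ite, mul_one, mul_zero]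

theorem exists_residue {p : ℕ} (hp : p ≠ 0) (x : σ →₀ ℕ) :
    ∃ (a : σ → Fin p) (m : σ →₀ ℕ), x = p • m + boxExp a := by
  refine ⟨fun i => ⟨x i % p, Nat.mod_lt _ (Nat.pos_of_ne_zero hp)⟩,
    x.mapRange (· / p) (Nat.zero_div p), ?_⟩
  ext i
  simp [Nat.div_add_mod]

theorem sum_residueSlice [DecidableEq σ] {p : ℕ} (hp : p ≠ 0) (P : MvPowerSeries σ F) :
    ∑ a : σ → Fin p, monomial (boxExp a) 1 * expand p hp (residueSlice a P) = P := by
  ext x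
  obtain ⟨b, m, rfl⟩ := exists_residue hp x
  rw [← coeff_residueSlice, map_sum]
  simp only [residueSlice_monomial_mul_expand]
  simp [coeff_residueSlice]

/-- `F⟦σ⟧` is free of rank `p ^ |σ|` over its subring of power series in the `xᵢ ^ p`. -/
theorem powDim_expand {p : ℕ} (hp : p ≠ 0) (f : MvPowerSeries σ F) (q : ℕ) :
    powDim (expand p hp f) (p * q) = p ^ Fintype.card σ * powDim f q := by
  classical
  have h : powDim (expand p hp f) (p * q) = ∑ _a : σ → Fin p, powDim f q := by
    refine finrank_quotient_eq_sum (F := F) _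
      (fun _ : σ → Fin p => powIdeal σ F q ⊔ Ideal.span {f}) (fun a => residueSlice a)
      (fun a y => monomial (boxExp a) 1 * expand p hp y) ?_ ?_ ?_ ?_
    · intro a x hx
      refine map_mem_of_mem_powIdeal_sup _ ?_ ?_ hx
      · intro i c
        rw [pow_mul, ← expand_X p hp i, ← map_pow, residueSlice_expand_mul]
        exact Ideal.mem_sup_left (Ideal.mul_mem_right _ _ (X_pow_mem_powIdeal q i))
      · intro c
        rw [residueSlice_expand_mul]
        exact Ideal.mul_mem_right _ _ (Ideal.mem_sup_right (Ideal.mem_span_singleton_self f))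
    · intro a y hy
      refine Ideal.mul_mem_left _ _ (map_mem_of_mem_powIdeal_sup
        (expand (R := F) (σ := σ) p hp).toLinearMap ?_ ?_ hy)
      · intro i c
        rw [AlgHom.toLinearMap_apply, map_mul, map_pow, expand_X, ← pow_mul]
        exact Ideal.mem_sup_left (Ideal.mul_mem_right _ _ (X_pow_mem_powIdeal _ i))
      · intro c
        rw [AlgHom.toLinearMap_apply, map_mul]
        exact Ideal.mul_mem_right _ _ (Ideal.mem_sup_right (Ideal.mem_span_singleton_self _))
    · intro a b y
      exact residueSlice_monomial_mul_expand hp a b y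
    · intro x
      rw [sum_residueSlice, sub_self]
      exact Ideal.zero_mem _
  rw [h]
  simp

/-- In characteristic p, f^p is f(x^p) with Frobenius applied to the coefficients. The coefficient
change preserves dimensions, and the substitution multiplies them by p^|σ|. -/
theorem powDim_pow_char (p : ℕ) [hp : Fact p.Prime] [CharP F p] (f : MvPowerSeries σ F) (q : ℕ) :
    powDim (f ^ p) (p * q) = p ^ Fintype.card σ * powDim f q := by
  rw [← map_frobenius_expand p hp.out.ne_zero, powDim_map, powDim_expand]

theorem pow_char_pow_mem_powIdeal (p : ℕ) [Fact p.Prime] [CharP F p] {f : MvPowerSeries σ F} (hf : constantCoeff f = 0) (n : ℕ) :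
    f ^ p ^ n ∈ powIdeal σ F (p ^ n) := by
  induction n with
  | zero =>
    rw [pow_zero, pow_one]
    exact mem_powIdeal_one hf
  | succ n ih =>
    rw [pow_succ, pow_mul, mul_comm]
    exact pow_char_mem_powIdeal p ih

theorem powDim_uvPlus_sq [CharP F 2] {g : MvPowerSeries σ F} (hg : constantCoeff g = 0) (n : ℕ) :
    powDim (uvPlus (g ^ 2)) (2 ^ (n + 1)) =
      2 ^ Fintype.card σ * powDim (uvPlus g) (2 ^ n) +
        2 ^ ((n + 1) * (Fintype.card σ + 1)) := by
  have hgn := pow_char_pow_mem_powIdeal 2 hg n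
  have hhn := pow_char_pow_mem_powIdeal 2 (f := g ^ 2) (by rw [map_pow, hg]; simp) (n + 1)
  have e₁ := powDim_uvPlus (by positivity) hgn
  have e₂ := powDim_uvPlus (by positivity) hhn
  have h₁ : ∀ k, powDim ((g ^ 2) ^ (k + 1)) (2 ^ (n + 1)) =
      2 ^ Fintype.card σ * powDim (g ^ (k + 1)) (2 ^ n) := fun k => by
    rw [← pow_mul, mul_comm, pow_mul, pow_succ' 2 n, powDim_pow_char]
  -- The upper half of the sum for g^2: these powers of g already lie in (x^q), so the dimension is
  -- the full q^|σ|.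
  have h₂ : ∀ k, powDim (g ^ (2 ^ n + k + 1)) (2 ^ n) = (2 ^ n) ^ Fintype.card σ := fun k =>
    powDim_of_mem (by rw [add_assoc, pow_add]; exact Ideal.mul_mem_right _ _ hgn)
  simp only [h₁, ← Finset.mul_sum] at e₂
  rw [show (2 : ℕ) ^ (n + 1) = 2 ^ n + 2 ^ n by ring, Finset.sum_range_add] at e₂
  simp only [h₂, Finset.sum_const, Finset.card_range, smul_eq_mul] at e₂
  rw [show (2 : ℕ) ^ n + 2 ^ n = 2 * 2 ^ n by ring, mul_pow] at e₂
  rw [show (2 : ℕ) ^ (n + 1) = 2 * 2 ^ n by ring,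
    show (2 : ℕ) ^ ((n + 1) * (Fintype.card σ + 1)) =
      2 * 2 ^ n * (2 ^ Fintype.card σ * (2 ^ n) ^ Fintype.card σ) by ring]
  generalize (2 : ℕ) ^ Fintype.card σ = A at *
  generalize (2 ^ n : ℕ) ^ Fintype.card σ = B at *
  generalize (2 : ℕ) ^ n = q at *
  zify at *
  linear_combination e₂ - A * e₁

theorem powDim_uvPlus_one {g : MvPowerSeries σ F} (hg : constantCoeff g = 0) :
    powDim (uvPlus g) 1 = 1 := by
  have h : g ^ 1 ∈ powIdeal σ F 1 := by
    rw [pow_one]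
    exact mem_powIdeal_one hg
  have := powDim_uvPlus one_ne_zero h
  simp only [one_pow, Finset.sum_range_one, zero_add, powDim_of_mem h] at this
  omega

end Fintype

theorem uvAdd_eq_uvPlus {r : ℕ} (g : MvPowerSeries (Fin r) F) : uvAdd g = uvPlus g := by
  rw [uvAdd, uvPlus, uvMonomial_eq, pow_one, pow_one]

end MvPowerSeries

/-! ### The recursion for e_n and its generating function -/

open MvPowerSeries in
theorem hilbertKunz_uvAdd_sq {F : Type*} [Field F] [CharP F 2] {r : ℕ}
    {g : MvPowerSeries (Fin r) F} (hg : constantCoeff g = 0) (n : ℕ) :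
    hilbertKunz (uvAdd (g ^ 2)) (n + 1) =
      2 ^ r * hilbertKunz (uvAdd g) n + 2 ^ ((n + 1) * (r + 1)) := by
  rw [hilbertKunz_eq_powDim, hilbertKunz_eq_powDim, uvAdd_eq_uvPlus, uvAdd_eq_uvPlus]
  simpa using powDim_uvPlus_sq hg n

open MvPowerSeries in
theorem hilbertKunz_uvAdd_zero {F : Type*} [Field F] [CharP F 2] {r : ℕ}
    {g : MvPowerSeries (Fin r) F} (hg : constantCoeff g = 0) :
    hilbertKunz (uvAdd g) 0 = 1 := by
  rw [hilbertKunz_eq_powDim, uvAdd_eq_uvPlus, pow_zero]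
  exact powDim_uvPlus_one hg

theorem theorem1p8 {F : Type*} [Field F] [CharP F 2] (r : ℕ) (g : MvPowerSeries (Fin r) F)
    (hg : MvPowerSeries.constantCoeff g = 0) :
    hkTheta (g ^ 2) = 1 + PowerSeries.C ((2 : ℤ) ^ r) * PowerSeries.X * hkTheta g := by
  have h₀ : hilbertKunz (uvAdd (g ^ 2)) 0 = 1 :=
    hilbertKunz_uvAdd_zero (by rw [map_pow, hg]; simp)
  -- At n = 0 the geometric series alone accounts for e_0 = 1; for n + 1 this is the recursion.
  have hS : (PowerSeries.mk fun n => (hilbertKunz (uvAdd (g ^ 2)) n : ℤ)) =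
      (PowerSeries.mk fun n => ((2 : ℤ) ^ (r + 1)) ^ n) +
        PowerSeries.C ((2 : ℤ) ^ r) * PowerSeries.X *
          PowerSeries.mk fun n => (hilbertKunz (uvAdd g) n : ℤ) := by
    ext n
    rw [map_add, mul_assoc, PowerSeries.coeff_C_mul]
    cases n with
    | zero => simp [h₀]
    | succ n =>
      rw [PowerSeries.coeff_succ_X_mul, PowerSeries.coeff_mk, PowerSeries.coeff_mk,
        PowerSeries.coeff_mk, hilbertKunz_uvAdd_sq hg]
      push_cast
      ring
  have hG : (1 - PowerSeries.C ((2 : ℤ) ^ (r + 1)) * PowerSeries.X) *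
      (PowerSeries.mk fun n => ((2 : ℤ) ^ (r + 1)) ^ n) = 1 := by
    ext n
    rw [sub_mul, one_mul, map_sub, mul_assoc, PowerSeries.coeff_C_mul]
    cases n with
    | zero => simp
    | succ n =>
      rw [PowerSeries.coeff_succ_X_mul, PowerSeries.coeff_mk, PowerSeries.coeff_mk,
        PowerSeries.coeff_one, if_neg (Nat.succ_ne_zero n)]
      ring
  rw [hkTheta, hkTheta, hS, mul_add, hG]
  ring
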